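/- Let $m,n\ge 1$, $A\in\mathbb{R}^{m\times n}$ with columns $\mathbf a_1,\dots,\mathbf a_n$, $\mathbf b\in\mathbb{R}^m$, $\mathbf c\in\mathbb{R}^n$, and put $\mathbf d=\mathbf b/n$. Consider the linear program $\max\{\langle \mathbf c,\mathbf x\rangle : A\mathbf x\le \mathbf b,\ \mathbf 0\le \mathbf x\le \mathbf 1\}$ and assume * (A1) $\max_i d_i=\bar d\ge \min_i d_i=\underline d>0$; * (A2) $\|\mathbf a_j\|_\infty\le\bar a$ and $|c_j|\le\bar c$ for all $j$, where $\bar c>0$; * (A3) for each $\mathbf y\ge\mathbf 0$, at most $m$ indices $j$ satisfy $c_j=\langle \mathbf a_j,\mathbf y\rangle$. Let $\gamma=\sqrt{\dfrac{2\bar c}{5\underline d(\bar a+\bar d)^2mn}}$. Given a permutation $\sigma$ of $\{1,\dots,n\}$, the online algorithm with implicit (proximal point) updates starts at $\mathbf y^1=\mathbf 0\in\mathbb{R}^m$ and, for $k=1,\dots,n$, with $j=\sigma(k)$, sets $$\mathbf y^{k+1}=\operatorname*{arg\,min}_{\mathbf y\ge \mathbf 0}\Big\{\langle \mathbf d,\mathbf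 y\rangle+[c_j-\langle \mathbf a_j,\mathbf y\rangle]_+ +\tfrac1{2\gamma}\|\mathbf y-\mathbf y^k\|^2\Big\},$$ and takes as $\hat x_j$ a Lagrange (KKT) multiplier of the constraint $s\ge c_j-\langle\mathbf a_j,\mathbf y\rangle$ at the optimal solution of the equivalent quadratic program $$\min_{\mathbf y,s}\Big\{\langle \mathbf d,\mathbf y\rangle+s+\tfrac1{2\gamma}\|\mathbf y-\mathbf y^k\|^2 : \mathbf y\ge\mathbf 0,\ s\ge c_j-\langle \mathbf a_j,\mathbf y\rangle,\ s\ge 0\Big\}$$ (any such multiplier if it is not unique). For the output $\hat{\mathbf x}$ let $\rho(\hat{\mathbf x})=\max\{\langle \mathbf c,\mathbf x\rangle: A\mathbf x\le\mathbf b,\ \mathbf 0\le\mathbf x\le\mathbf 1\}-\langle \mathbf c,\hat{\mathbf x}\rangle$ be the optimality gap and $v(\hat{\mathbf x})=\|[A\hat{\mathbf x}-\mathbf b]_+\|$ (Euclidean norm) the constraint violation. Then, with the expectation taken over a uniformly random permutation $\sigma$, $$\mathbb E[\rho(\hat{\mathbf x})]\le C\,(m\log n+\sqrt n\log n)+\Big(\frac{5(\bar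 a+\bar d)^2\bar c}{2\underline d}\Big)^{1/2}\sqrt{mn},$$ $$\mathbb E[v(\hat{\mathbf x})]\le \frac{3m(\bar a+\bar d)^2}{\underline d}+\sqrt m\,(\bar a+\bar d)+\Big(\frac{5(\bar a+\bar d)^2\bar c}{2\underline d}\Big)^{1/2}\sqrt{mn},$$ where the constant $C$ depends only on $\bar a$, $\bar c$ and $\underline d$. -/

import Mathlib

open scoped BigOperators Matrix

noncomputable section

namespace FastOnlineLP

variable {m n : ℕ}

/-- The Euclidean norm on `ℝ^m`. -/
def euclNorm (v : Fin m → ℝ) : ℝ := ‖(WithLp.toLp 2 v : EuclideanSpace ℝ (Fin m))‖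

/-- The vector `d = b / n` of average resources. -/
def avgRes (n : ℕ) (b : Fin m → ℝ) : Fin m → ℝ := fun i => b i / (n : ℝ)

/-- The feasible set `{x : A x ≤ b, 0 ≤ x ≤ 1}` of the linear program. -/
def primalFeasible (A : Matrix (Fin m) (Fin n) ℝ) (b : Fin m → ℝ) : Set (Fin n → ℝ) :=
  {x | A *ᵥ x ≤ b ∧ 0 ≤ x ∧ x ≤ 1}

/-- The optimal value `max {⟨c, x⟩ : A x ≤ b, 0 ≤ x ≤ 1}`. When `0 ≤ b` the feasible set is compact
and contains `0`, so that the supremum is a maximum. -/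
def optValue (A : Matrix (Fin m) (Fin n) ℝ) (b : Fin m → ℝ) (c : Fin n → ℝ) : ℝ :=
  sSup ((fun x => c ⬝ᵥ x) '' primalFeasible A b)

/-- The optimality gap `ρ(x̂)`. -/
def optGap (A : Matrix (Fin m) (Fin n) ℝ) (b : Fin m → ℝ) (c : Fin n → ℝ)
    (xhat : Fin n → ℝ) : ℝ :=
  optValue A b c - c ⬝ᵥ xhat

/-- The constraint violation `v(x̂) = ‖[A x̂ - b]₊‖`. -/
def violation (A : Matrix (Fin m) (Fin n) ℝ) (b : Fin m → ℝ) (xhat : Fin n → ℝ) : ℝ :=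
  euclNorm (fun i => max ((A *ᵥ xhat) i - b i) 0)

/-- The standing assumptions on the data of the linear program. -/
structure Assumptions (A : Matrix (Fin m) (Fin n) ℝ) (b : Fin m → ℝ) (c : Fin n → ℝ)
    (abar cbar dlow dbar : ℝ) : Prop where
  /-- `dbar` is the largest entry of `d = b / n`. -/
  max_d : IsGreatest (Set.range (avgRes n b)) dbar
  /-- `dlow` is the smallest entry of `d = b / n`. -/
  min_d : IsLeast (Set.range (avgRes n b)) dlow
  /-- The smallest entry of `d` is positive. -/
  dlow_pos : 0 < dlow
  /-- `‖a_j‖_∞ ≤ abar` for every column `a_j` of `A`. -/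
  bound_a : ∀ j i, |A i j| ≤ abar
  /-- `|c_j| ≤ cbar` for every `j`. -/
  bound_c : ∀ j, |c j| ≤ cbar
  /-- For each `y ≥ 0`, at most `m` columns satisfy `c_j = ⟨a_j, y⟩`. -/
  general_position : ∀ y : Fin m → ℝ, 0 ≤ y → {j : Fin n | c j = A.col j ⬝ᵥ y}.ncard ≤ m

/-- The one-column dual function `f(y) = ⟨d, y⟩ + [c - ⟨a, y⟩]₊`. -/
def colFun (d a : Fin m → ℝ) (c : ℝ) (y : Fin m → ℝ) : ℝ :=
  d ⬝ᵥ y + max (c - a ⬝ᵥ y) 0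

/-- The feasible set `{(y, s) : y ≥ 0, s ≥ c - ⟨a, y⟩, s ≥ 0}` of the one-column quadratic
program. -/
def qpFeasible (a : Fin m → ℝ) (c : ℝ) : Set ((Fin m → ℝ) × ℝ) :=
  {p | 0 ≤ p.1 ∧ c - a ⬝ᵥ p.1 ≤ p.2 ∧ 0 ≤ p.2}

/-- The objective `⟨d, y⟩ + s + ‖y - z‖² / (2 γ)` of the one-column quadratic program. -/
def qpObjective (d : Fin m → ℝ) (γ : ℝ) (z : Fin m → ℝ) (p : (Fin m → ℝ) × ℝ) : ℝ :=
  d ⬝ᵥ p.1 + p.2 + 1 / (2 * γ) * euclNorm (p.1 - z) ^ 2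

/-- The Karush-Kuhn-Tucker conditions of the one-column quadratic program at `(y, s)`, with
multipliers `x` of `s ≥ c - ⟨a, y⟩`, `v` of `s ≥ 0` and `w` of `y ≥ 0`. -/
structure IsKKT (d a : Fin m → ℝ) (c γ : ℝ) (z y : Fin m → ℝ) (s x v : ℝ)
    (w : Fin m → ℝ) : Prop where
  feasible : (y, s) ∈ qpFeasible a c
  multiplier_nonneg : 0 ≤ x ∧ 0 ≤ v ∧ 0 ≤ w
  stationary_y : d + γ⁻¹ • (y - z) - x • a - w = 0
  stationary_s : 1 - x - v = 0
  slack_x : x * (c - a ⬝ᵥ y - s) = 0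
  slack_v : v * s = 0
  slack_w : y ⬝ᵥ w = 0

/-- One implicit (proximal point) step from `z` on the column `(a, c)` with stepsize `γ`:
`y` is the new dual iterate and `x` the primal estimate, that is, a Lagrange multiplier of the
constraint `s ≥ c - ⟨a, y⟩` at the optimal solution of the one-column quadratic program. (The
iterate `y` is unique; where the multiplier is not unique, any one is allowed.) -/
structure IsImplicitStep (d a : Fin m → ℝ) (c γ : ℝ) (z y : Fin m → ℝ) (x : ℝ) : Prop where
  nonneg : 0 ≤ y
  argmin : IsMinOn (fun u => colFun d a c u + 1 / (2 * γ) * euclNorm (u - z) ^ 2) {u | 0 ≤ u} y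
  multiplier : ∃ (s v : ℝ) (w : Fin m → ℝ),
    IsMinOn (qpObjective d γ z) (qpFeasible a c) (y, s) ∧ IsKKT d a c γ z y s x v w

/-- A run of the online algorithm with implicit updates and constant stepsize `γ` that visits the
columns in the order `σ 0, σ 1, …, σ (n - 1)`, starting at the dual iterate `0`: `y` is the sequence
of dual iterates, and `xhat` the output, whose entry at the column `σ k` is the estimate made in
step `k`. -/
structure IsImplicitRun (A : Matrix (Fin m) (Fin n) ℝ) (b : Fin m → ℝ) (c : Fin n → ℝ) (γ : ℝ)
    (σ : Equiv.Perm (Fin n)) (y : Fin (n + 1) → Fin m → ℝ) (xhat : Fin n → ℝ) : Prop where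
  init : y 0 = 0
  step : ∀ k : Fin n,
    IsImplicitStep (avgRes n b) (A.col (σ k)) (c (σ k)) γ (y k.castSucc) (y k.succ) (xhat (σ k))

/-- The stepsize `√(2 c̄ / (5 d̲ (ā + d̄)² m n))`. -/
def stepsize (abar cbar dlow dbar : ℝ) (m n : ℕ) : ℝ :=
  √(2 * cbar / (5 * dlow * (abar + dbar) ^ 2 * m * n))

end FastOnlineLP

end

/-! Everything rests on the KKT conditions of one implicit step from `z` to `y`.

Violation: stationarity bounds the overuse of resource `i` by `γ⁻¹ * (y i - z i)`
(`IsKKT.residual_le`), which telescopes to the last iterate over `γ`. Since every `d i` is at least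
`dlow`, the ball of radius `cbar / dlow` traps the iterates (`IsKKT.dotProduct_self_le`). Hence the
violation is at most `cbar / (γ * dlow)` for every order of the columns.

Gap: complementary slackness turns the reward of a step into the dual value at the old iterate, plus
a telescoping difference of squared norms, minus `γ * m * D ^ 2 / 2` (`IsKKT.colFun_le_reward`). It
remains to bound the expected dual values from below. The iterate before step `k` depends only on
the columns already seen (`iterate_congr`), so the next column may be replaced by the average of the
remaining ones (`card_mul_expect_colFun`). A feasible point, restricted to these columns and scaled
by some `θ` close to `1`, respects their share of the resources with high probability
(`expect_perm_tail_le`); weak duality then compares its reward with the dual values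
(`sum_reward_le_sum_colFun`). With `s` columns left the loss is of order `√(log n / s) + m / s`, and
summing over `s` gives the logarithmic terms.

The stepsize makes the violation bound equal to the term `R` in `√(m * n)`, and the accumulated
stepsize loss equal to `R / 5`. -/

namespace FastOnlineLP

/-! ### Sampling without replacement. -/

section Sampling

variable {n : ℕ}

/-- Right translation permutes positions; the exchangeability arguments below use it with `τ` a
transposition. -/
lemma expect_perm_mul_right (F : Equiv.Perm (Fin n) → ℝ) (τ : Equiv.Perm (Fin n)) :
    (𝔼 σ, F (σ * τ)) = 𝔼 σ, F σ :=
  Fintype.expect_equiv (Equiv.mulRight τ) _ _ fun _ => rfl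

/-- The value of a random permutation at any fixed position is uniformly distributed. -/
lemma expect_perm_apply (v : Fin n → ℝ) (i : Fin n) :
    (𝔼 σ : Equiv.Perm (Fin n), v (σ i)) = (∑ j, v j) / n := by
  have hn : (n : ℝ) ≠ 0 := by
    have := i.pos
    positivity
  have key : ∀ l : Fin n, (𝔼 σ : Equiv.Perm (Fin n), v (σ l)) =
      𝔼 σ : Equiv.Perm (Fin n), v (σ i) := fun l => by
    simpa using (expect_perm_mul_right (fun σ => v (σ l)) (Equiv.swap i l)).symm
  have h : ∑ l : Fin n, (𝔼 σ : Equiv.Perm (Fin n), v (σ l)) = ∑ j, v j := by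
    rw [← Finset.expect_sum_comm]
    simp_rw [Equiv.sum_comp]
    exact Fintype.expect_const _
  rw [← h, Finset.sum_congr rfl fun l _ => key l]
  simp [hn]

/-- Sampling without replacement: the mean of a product of positive values is at most the product
of the means. -/
lemma expect_perm_prod_le (u : Fin n → ℝ) (hu : ∀ j, 0 ≤ u j) (P : Finset (Fin n)) :
    (𝔼 σ : Equiv.Perm (Fin n), ∏ i ∈ P, u (σ i)) ≤ ((∑ j, u j) / n) ^ P.card := by
  induction P using Finset.induction_on with
  | empty => simp
  | insert a P ha ih =>
    have hn : (0 : ℝ) < n := by exact_mod_cast a.pos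
    set M : ℝ := 𝔼 σ : Equiv.Perm (Fin n), ∏ i ∈ insert a P, u (σ i) with hM
    -- Compare with a fresh draw, averaging over all `l`. If `l ∉ P`, swapping `a` and `l` gives
    -- equality. If `l ∈ P`, the factor at `l` is repeated, and `u (σ a) * u (σ l)` is at most the
    -- mean of the two squares, whose expectations agree by symmetry. The sum over `l` of `u (σ l)`
    -- does not depend on `σ`.
    have hl : ∀ l : Fin n, M ≤ 𝔼 σ : Equiv.Perm (Fin n), (∏ i ∈ P, u (σ i)) * u (σ l) := by
      intro l
      by_cases hlP : l ∈ P
      · have hal : a ≠ l := fun h => ha (h ▸ hlP)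
        set Q := P.erase l
        have hP : ∀ σ : Equiv.Perm (Fin n), ∏ i ∈ P, u (σ i) = u (σ l) * ∏ i ∈ Q, u (σ i) :=
          fun σ => (Finset.mul_prod_erase P (fun i => u (σ i)) hlP).symm
        have hsw : (𝔼 σ : Equiv.Perm (Fin n), (∏ i ∈ Q, u (σ i)) * u (σ a) ^ 2) =
            𝔼 σ : Equiv.Perm (Fin n), (∏ i ∈ Q, u (σ i)) * u (σ l) ^ 2 := by
          rw [← expect_perm_mul_right
            (fun σ => (∏ i ∈ Q, u (σ i)) * u (σ l) ^ 2) (Equiv.swap a l)]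
          refine Finset.expect_congr rfl fun σ _ => ?_
          have : ∏ i ∈ Q, u (σ i) = ∏ i ∈ Q, u ((σ * Equiv.swap a l) i) := by
            refine Finset.prod_congr rfl fun i hi => ?_
            rw [Equiv.Perm.mul_apply, Equiv.swap_apply_of_ne_of_ne]
            · exact fun h => ha (h ▸ Finset.mem_of_mem_erase hi)
            · exact Finset.ne_of_mem_erase hi
          rw [this]
          simp
        have h1 : M ≤ 𝔼 σ : Equiv.Perm (Fin n), ((∏ i ∈ Q, u (σ i)) * u (σ a) ^ 2 +
            (∏ i ∈ Q, u (σ i)) * u (σ l) ^ 2) / 2 := by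
          refine Finset.expect_le_expect fun σ _ => ?_
          rw [Finset.prod_insert ha, hP]
          have hQ : 0 ≤ ∏ i ∈ Q, u (σ i) := Finset.prod_nonneg fun i _ => hu _
          nlinarith [mul_nonneg hQ (sq_nonneg (u (σ a) - u (σ l)))]
        have h2 : (𝔼 σ : Equiv.Perm (Fin n), (∏ i ∈ P, u (σ i)) * u (σ l)) =
            𝔼 σ : Equiv.Perm (Fin n), (∏ i ∈ Q, u (σ i)) * u (σ l) ^ 2 :=
          Finset.expect_congr rfl fun σ _ => by rw [hP]; ring
        rw [← Finset.expect_div, Finset.expect_add_distrib, hsw] at h1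
        rw [h2]
        linarith
      · refine le_of_eq ?_
        rw [hM, ← expect_perm_mul_right
            (fun σ => (∏ i ∈ P, u (σ i)) * u (σ l)) (Equiv.swap a l)]
        refine Finset.expect_congr rfl fun σ _ => ?_
        have : ∏ i ∈ P, u (σ i) = ∏ i ∈ P, u ((σ * Equiv.swap a l) i) := by
          refine Finset.prod_congr rfl fun i hi => ?_
          rw [Equiv.Perm.mul_apply, Equiv.swap_apply_of_ne_of_ne]
          · exact fun h => ha (h ▸ hi)
          · exact fun h => hlP (h ▸ hi)
        rw [Finset.prod_insert ha, this]
        simp [mul_comm]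
    have hsum : (n : ℝ) * M ≤
        (𝔼 σ : Equiv.Perm (Fin n), ∏ i ∈ P, u (σ i)) * ∑ j, u j := by
      calc (n : ℝ) * M = ∑ _l : Fin n, M := by simp
        _ ≤ ∑ l : Fin n, 𝔼 σ : Equiv.Perm (Fin n), (∏ i ∈ P, u (σ i)) * u (σ l) :=
          Finset.sum_le_sum fun l _ => hl l
        _ = _ := by
          rw [← Finset.expect_sum_comm, Finset.expect_mul]
          refine Finset.expect_congr rfl fun σ _ => ?_
          rw [← Finset.mul_sum, Equiv.sum_comp σ u]
    have hU : 0 ≤ (∑ j, u j) / n := div_nonneg (Finset.sum_nonneg fun j _ => hu j) hn.le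
    calc M ≤ (𝔼 σ : Equiv.Perm (Fin n), ∏ i ∈ P, u (σ i)) * ((∑ j, u j) / n) := by
          rw [← mul_div_assoc, le_div_iff₀ hn]; linarith
      _ ≤ _ := by
          rw [Finset.card_insert_of_notMem ha, pow_succ]
          exact mul_le_mul_of_nonneg_right ih hU

/-- A Hoeffding-type bound for sampling without replacement. -/
lemma expect_perm_tail_le (v : Fin n → ℝ) {α δ : ℝ} (hα : 0 < α) (hv : ∀ j, |v j| ≤ α)
    (hmean : (∑ j, v j) / n ≤ δ) (P : Finset (Fin n)) (hP : P.Nonempty) :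
    (𝔼 σ : Equiv.Perm (Fin n),
      if P.card * δ + 2 * α * √(P.card * Real.log P.card) < ∑ i ∈ P, v (σ i)
        then (1 : ℝ) else 0) ≤ 1 / P.card := by
  set s : ℝ := (P.card : ℝ) with hs
  have hs1 : 1 ≤ s := by rw [hs]; exact_mod_cast hP.card_pos
  have hs0 : 0 < s := by linarith
  have hn : (0 : ℝ) < n := by
    obtain ⟨a, _⟩ := hP
    exact_mod_cast a.pos
  have hlog : 0 ≤ Real.log s := Real.log_nonneg hs1
  set r : ℝ := √(Real.log s / s) with hr
  have hr0 : 0 ≤ r := Real.sqrt_nonneg _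
  have hr2 : r ^ 2 = Real.log s / s := Real.sq_sqrt (by positivity)
  have hr1 : r ≤ 1 := by
    refine Real.sqrt_le_one.mpr ((div_le_one hs0).mpr ?_)
    linarith [Real.log_le_sub_one_of_pos hs0]
  have hsr : √(s * Real.log s) = s * r := by
    have : s * Real.log s = (s * r) ^ 2 := by rw [mul_pow, hr2]; field_simp
    rw [this, Real.sqrt_sq (by positivity)]
  rw [hsr]
  -- Chernoff parameter: `|q * v j| ≤ r ≤ 1` permits `exp t ≤ 1 + t + t ^ 2`, and the final exponent
  -- is `-2 * s * r ^ 2 + s * r ^ 2 = -log s`.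
  set q : ℝ := r / α with hq
  have hq0 : 0 ≤ q := by positivity
  have hqα : q * α = r := by rw [hq]; field_simp
  have hexp : (∑ j, Real.exp (q * v j)) / n ≤ Real.exp (q * δ + r ^ 2) := by
    have h1 : ∀ j, Real.exp (q * v j) ≤ 1 + q * v j + r ^ 2 := fun j => by
      have hle : |q * v j| ≤ r := by
        rw [abs_mul, abs_of_nonneg hq0, ← hqα]
        exact mul_le_mul_of_nonneg_left (hv j) hq0
      have := (abs_le.mp (Real.abs_exp_sub_one_sub_id_le (hle.trans hr1))).2
      have h2 : (q * v j) ^ 2 ≤ r ^ 2 := sq_le_sq' (by linarith [(abs_le.mp hle).1])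
        (abs_le.mp hle).2
      linarith
    calc (∑ j, Real.exp (q * v j)) / n ≤ (∑ j, (1 + q * v j + r ^ 2)) / n := by
          gcongr with j; exact h1 j
      _ = 1 + q * ((∑ j, v j) / n) + r ^ 2 := by
          rw [Finset.sum_add_distrib, Finset.sum_add_distrib, ← Finset.mul_sum]
          simp
          field_simp
      _ ≤ (q * δ + r ^ 2) + 1 := by nlinarith
      _ ≤ _ := Real.add_one_le_exp _
  calc _ ≤ 𝔼 σ : Equiv.Perm (Fin n), Real.exp (-(q * (s * δ + 2 * α * (s * r)))) *
          ∏ i ∈ P, Real.exp (q * v (σ i)) := by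
        refine Finset.expect_le_expect fun σ _ => ?_
        rw [← Real.exp_sum, ← Finset.mul_sum, ← Real.exp_add]
        split_ifs with h
        · apply Real.one_le_exp
          have := mul_le_mul_of_nonneg_left h.le hq0
          linarith
        · positivity
    _ ≤ Real.exp (-(q * (s * δ + 2 * α * (s * r)))) *
          ((∑ j, Real.exp (q * v j)) / n) ^ P.card := by
        rw [← Finset.mul_expect]
        exact mul_le_mul_of_nonneg_left
          (expect_perm_prod_le (fun j => Real.exp (q * v j)) (fun j => (Real.exp_pos _).le) P)
          (Real.exp_pos _).le
    _ ≤ Real.exp (-(q * (s * δ + 2 * α * (s * r)))) * Real.exp (q * δ + r ^ 2) ^ P.card := by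
        gcongr
    _ = Real.exp (-Real.log s) := by
        rw [← Real.exp_nat_mul, ← hs, ← Real.exp_add]
        congr 1
        have h1 : q * (2 * α * (s * r)) = 2 * (s * r ^ 2) := by
          rw [show q * (2 * α * (s * r)) = 2 * (q * α) * (s * r) by ring, hqα]; ring
        have h2 : s * r ^ 2 = Real.log s := by rw [hr2]; field_simp
        linear_combination (-1 : ℝ) * h1 - h2
    _ = 1 / s := by rw [Real.exp_neg, Real.exp_log hs0, one_div]

end Sampling

end FastOnlineLP

namespace FastOnlineLP

/-! ### KKT analysis of a single implicit step. -/

section ImplicitStep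

variable {m : ℕ}

lemma euclNorm_sq (v : Fin m → ℝ) : euclNorm v ^ 2 = v ⬝ᵥ v := by
  rw [euclNorm, EuclideanSpace.norm_sq_eq]; simp [dotProduct, sq]

lemma euclNorm_le_iff {v : Fin m → ℝ} {r : ℝ} (hr : 0 ≤ r) :
    euclNorm v ≤ r ↔ v ⬝ᵥ v ≤ r ^ 2 := by
  rw [← euclNorm_sq]; exact (sq_le_sq₀ (norm_nonneg _) hr).symm

lemma dotProduct_le_half (v w : Fin m → ℝ) : v ⬝ᵥ w ≤ (v ⬝ᵥ v + w ⬝ᵥ w) / 2 := by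
  simp only [dotProduct, ← Finset.sum_add_distrib, Finset.sum_div]
  exact Finset.sum_le_sum fun i _ => by nlinarith [sq_nonneg (v i - w i)]

lemma dotProduct_self_le_sum_sq {y : Fin m → ℝ} (hy : 0 ≤ y) : y ⬝ᵥ y ≤ (∑ i, y i) ^ 2 := by
  simpa [dotProduct, sq] using Finset.sum_sq_le_sq_sum_of_nonneg (s := Finset.univ) fun i _ => hy i

lemma colFun_nonneg {d a y : Fin m → ℝ} {c : ℝ} (hd : 0 ≤ d) (hy : 0 ≤ y) :
    0 ≤ colFun d a c y :=
  add_nonneg (dotProduct_nonneg_of_nonneg hd hy) (le_max_right _ _)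

/-- The affine minorants `⟨d, y⟩ + x (c - ⟨a, y⟩)`, `0 ≤ x ≤ 1`, of the one-column dual function. -/
lemma le_colFun {d a y : Fin m → ℝ} {c x : ℝ} (h0 : 0 ≤ x) (h1 : x ≤ 1) :
    d ⬝ᵥ y + x * (c - a ⬝ᵥ y) ≤ colFun d a c y := by
  unfold colFun
  have := le_max_left (c - a ⬝ᵥ y) 0
  have := le_max_right (c - a ⬝ᵥ y) 0
  nlinarith

variable {d a : Fin m → ℝ} {c γ : ℝ} {z y : Fin m → ℝ} {s x v : ℝ} {w : Fin m → ℝ}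

namespace IsKKT

lemma le_one (h : IsKKT d a c γ z y s x v w) : x ≤ 1 := by
  have := h.stationary_s
  have := h.multiplier_nonneg.2.1
  linarith

lemma mul_slack (h : IsKKT d a c γ z y s x v w) : x * (c - a ⬝ᵥ y) = s := by
  have h1 := h.slack_x
  have h2 := h.slack_v
  have h3 : v = 1 - x := by linarith [h.stationary_s]
  subst h3
  linarith

lemma slack_eq (h : IsKKT d a c γ z y s x v w) : s = max (c - a ⬝ᵥ y) 0 := by
  obtain ⟨-, h1, h2⟩ := h.feasible
  refine le_antisymm ?_ (max_le h1 h2)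
  have h3 := h.mul_slack
  have := le_max_left (c - a ⬝ᵥ y) 0
  have := le_max_right (c - a ⬝ᵥ y) 0
  nlinarith [h.multiplier_nonneg.1, h.le_one]

lemma multiplier_eq (h : IsKKT d a c γ z y s x v w) (i : Fin m) :
    w i = d i + γ⁻¹ * (y i - z i) - x * a i := by
  have := congrFun h.stationary_y i
  simp at this
  linarith

lemma residual_le (h : IsKKT d a c γ z y s x v w) (i : Fin m) :
    a i * x - d i ≤ γ⁻¹ * (y i - z i) := by
  have h1 := h.multiplier_nonneg.2.2 i
  rw [h.multiplier_eq i] at h1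
  simp at h1
  linarith

lemma dotProduct_stationary (h : IsKKT d a c γ z y s x v w) (u : Fin m → ℝ) :
    u ⬝ᵥ w = d ⬝ᵥ u + γ⁻¹ * (y ⬝ᵥ u - z ⬝ᵥ u) - x * (a ⬝ᵥ u) := by
  have : w = d + γ⁻¹ • (y - z) - x • a := by
    funext i; rw [h.multiplier_eq i]; simp
  rw [dotProduct_comm, this]
  simp [add_dotProduct, sub_dotProduct, smul_dotProduct]

/-- Pairing stationarity with `y` itself eliminates `w` by complementary slackness. -/
lemma mul_dotProduct_sub (h : IsKKT d a c γ z y s x v w) :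
    x * (a ⬝ᵥ y) - d ⬝ᵥ y = γ⁻¹ * (y ⬝ᵥ y - z ⬝ᵥ y) := by
  have := h.dotProduct_stationary y
  rw [h.slack_w] at this
  linarith

/-- The proximal point is unique. -/
lemma unique (hγ : 0 < γ) (h : IsKKT d a c γ z y s x v w) {y' : Fin m → ℝ} {s' x' v' : ℝ}
    {w' : Fin m → ℝ} (h' : IsKKT d a c γ z y' s' x' v' w') : y = y' := by
  have e1 := h.dotProduct_stationary y'
  have e2 := h'.dotProduct_stationary y
  have e3 := h.mul_dotProduct_sub
  have e4 := h'.mul_dotProduct_sub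
  have p1 := dotProduct_nonneg_of_nonneg h'.feasible.1 h.multiplier_nonneg.2.2
  have p2 := dotProduct_nonneg_of_nonneg h.feasible.1 h'.multiplier_nonneg.2.2
  have hx := h.mul_slack
  have hx' := h'.mul_slack
  obtain ⟨-, f1, f2⟩ := h.feasible
  obtain ⟨-, f1', f2'⟩ := h'.feasible
  have g1 : x' * (c - a ⬝ᵥ y) ≤ s :=
    (mul_le_mul_of_nonneg_left f1 h'.multiplier_nonneg.1).trans
      (mul_le_of_le_one_left f2 h'.le_one)
  have g2 : x * (c - a ⬝ᵥ y') ≤ s' :=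
    (mul_le_mul_of_nonneg_left f1' h.multiplier_nonneg.1).trans
      (mul_le_of_le_one_left f2' h.le_one)
  simp only at f1 f2 f1' f2'
  -- Strong monotonicity: each stationarity condition is tested against both points and the results
  -- are combined. The terms in `d` and `z` cancel, and those in `x`, `x'` have the right sign by
  -- `g1` and `g2`.
  have key : γ⁻¹ * ((y - y') ⬝ᵥ (y - y')) ≤ 0 := by
    have : (y - y') ⬝ᵥ (y - y') = y ⬝ᵥ y - y ⬝ᵥ y' - y' ⬝ᵥ y + y' ⬝ᵥ y' := by
      simp [sub_dotProduct, dotProduct_sub]; ring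
    rw [this]
    nlinarith
  have hz : (y - y') ⬝ᵥ (y - y') = 0 := by
    have h0 : 0 ≤ (y - y') ⬝ᵥ (y - y') := by rw [← euclNorm_sq]; positivity
    have := inv_pos.mpr hγ
    nlinarith
  exact sub_eq_zero.mp (dotProduct_self_eq_zero.mp hz)

lemma mul_dotProduct_le (h : IsKKT d a c γ z y s x v w) {cbar : ℝ} (hc : |c| ≤ cbar) :
    x * (a ⬝ᵥ y) ≤ cbar := by
  have h1 := h.mul_slack
  have h2 := h.feasible.2.2
  have h3 := h.le_one
  have h4 := h.multiplier_nonneg.1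
  have h5 := (le_abs_self c).trans hc
  have h6 := (abs_nonneg c).trans hc
  simp only at h2
  nlinarith

/-- The ball of radius `cbar / dlow` is invariant under implicit steps. -/
lemma dotProduct_self_le (hγ : 0 < γ) (h : IsKKT d a c γ z y s x v w) {cbar dlow : ℝ}
    (hc : |c| ≤ cbar) (hd0 : 0 < dlow) (hd : ∀ i, dlow ≤ d i)
    (hz : z ⬝ᵥ z ≤ (cbar / dlow) ^ 2) : y ⬝ᵥ y ≤ (cbar / dlow) ^ 2 := by
  by_contra! hlt
  have hcb := (abs_nonneg c).trans hc
  have hy := h.feasible.1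
  have h1 : dlow * ∑ i, y i ≤ d ⬝ᵥ y := by
    rw [Finset.mul_sum]
    exact Finset.sum_le_sum fun i _ => mul_le_mul_of_nonneg_right (hd i) (hy i)
  -- Outside the ball the sum of the entries, which dominates the Euclidean norm, forces `d ⬝ᵥ y >
  -- cbar ≥ x * (a ⬝ᵥ y)`. Then `y ⬝ᵥ y ≤ z ⬝ᵥ y`, so the step cannot have increased the norm.
  have h2 : cbar / dlow < ∑ i, y i :=
    lt_of_pow_lt_pow_left₀ 2 (Finset.sum_nonneg fun i _ => hy i)
      (hlt.trans_le (dotProduct_self_le_sum_sq hy))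
  rw [div_lt_iff₀ hd0] at h2
  have h3 := h.mul_dotProduct_sub
  have h4 := h.mul_dotProduct_le hc
  have h5 : γ⁻¹ * (y ⬝ᵥ y - z ⬝ᵥ y) ≤ 0 := by linarith
  have h6 : y ⬝ᵥ y - z ⬝ᵥ y ≤ 0 := by
    by_contra! hpos
    have := mul_pos (inv_pos.mpr hγ) hpos
    linarith
  have := dotProduct_le_half z y
  linarith

/-- The reward of an implicit step, compared with the dual function at the old iterate. -/
lemma colFun_le_reward (hγ : 0 < γ) (h : IsKKT d a c γ z y s x v w) {D : ℝ}
    (hd : ∀ i, |d i| ≤ D) (hda : ∀ i, |d i - a i| ≤ D) :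
    colFun d a c z + (y ⬝ᵥ y - z ⬝ᵥ z) / (2 * γ) - γ * m * D ^ 2 / 2 ≤ c * x := by
  have hs := h.mul_slack
  rw [h.slack_eq] at hs
  have h1 : c * x = colFun d a c y + γ⁻¹ * (y ⬝ᵥ y - z ⬝ᵥ y) := by
    rw [← h.mul_dotProduct_sub, colFun]; linarith
  -- Young's inequality by completing the square; it is used for the two slopes `d` and `d - a` of
  -- the dual function. The quadratic term it costs is repaid exactly by the one in `h4`.
  have h2 : ∀ e : Fin m → ℝ, (∀ i, |e i| ≤ D) →
      e ⬝ᵥ (z - y) ≤ (y - z) ⬝ᵥ (y - z) / (2 * γ) + γ * m * D ^ 2 / 2 := by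
    intro e he
    have : (y - z) ⬝ᵥ (y - z) / (2 * γ) + γ * m * D ^ 2 / 2 =
        ∑ i, ((y i - z i) ^ 2 / (2 * γ) + γ * D ^ 2 / 2) := by
      rw [Finset.sum_add_distrib, ← Finset.sum_div]
      simp [dotProduct, sq]; ring
    rw [this]
    refine Finset.sum_le_sum fun i _ => ?_
    have h3 : e i ^ 2 ≤ D ^ 2 := sq_le_sq' (by linarith [(abs_le.mp (he i)).1])
      (abs_le.mp (he i)).2
    have h4 : (y i - z i) ^ 2 / (2 * γ) + γ * D ^ 2 / 2 - e i * (z i - y i) =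
        ((y i - z i) + γ * e i) ^ 2 / (2 * γ) + γ * (D ^ 2 - e i ^ 2) / 2 := by
      field_simp; ring
    have h5 : 0 ≤ ((y i - z i) + γ * e i) ^ 2 / (2 * γ) + γ * (D ^ 2 - e i ^ 2) / 2 := by
      have : 0 ≤ D ^ 2 - e i ^ 2 := by linarith
      positivity
    simp only [Pi.sub_apply]
    linarith
  have h3 : colFun d a c z - colFun d a c y ≤
      (y - z) ⬝ᵥ (y - z) / (2 * γ) + γ * m * D ^ 2 / 2 := by
    have e1 := h2 d hd
    have e2 := h2 (d - a) hda
    simp only [sub_dotProduct, dotProduct_sub] at e1 e2 ⊢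
    unfold colFun
    have m1 := le_max_left (c - a ⬝ᵥ y) 0
    have m2 := le_max_right (c - a ⬝ᵥ y) 0
    rcases max_cases (c - a ⬝ᵥ z) 0 with ⟨h, -⟩ | ⟨h, -⟩ <;> rw [h] <;> linarith
  have h4 : γ⁻¹ * (y ⬝ᵥ y - z ⬝ᵥ y) =
      (y ⬝ᵥ y - z ⬝ᵥ z) / (2 * γ) + (y - z) ⬝ᵥ (y - z) / (2 * γ) := by
    simp only [sub_dotProduct, dotProduct_sub, dotProduct_comm y z]
    field_simp; ring
  linarith

end IsKKT

end ImplicitStep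

/-! ### Telescoping along a run. -/

section Run

variable {m n : ℕ} {A : Matrix (Fin m) (Fin n) ℝ} {b : Fin m → ℝ} {c : Fin n → ℝ} {γ : ℝ}
  {σ : Equiv.Perm (Fin n)} {y : Fin (n + 1) → Fin m → ℝ} {xhat : Fin n → ℝ}

lemma sum_succ_sub_castSucc (f : Fin (n + 1) → ℝ) :
    ∑ k : Fin n, (f k.succ - f k.castSucc) = f (Fin.last n) - f 0 := by
  have h1 := Fin.sum_univ_succ f
  have h2 := Fin.sum_univ_castSucc f
  rw [Finset.sum_sub_distrib]
  linarith

namespace IsImplicitRun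

lemma iterate_nonneg (h : IsImplicitRun A b c γ σ y xhat) (k : Fin (n + 1)) : 0 ≤ y k := by
  refine Fin.cases ?_ (fun k => ?_) k
  · rw [h.init]
  · exact (h.step k).nonneg

/-- Uniqueness of the proximal point makes an iterate a function of the columns already seen,
whichever runs are chosen for different permutations. -/
lemma iterate_congr (hγ : 0 < γ) (h : IsImplicitRun A b c γ σ y xhat) {σ' : Equiv.Perm (Fin n)}
    {y' : Fin (n + 1) → Fin m → ℝ} {xhat' : Fin n → ℝ}
    (h' : IsImplicitRun A b c γ σ' y' xhat') (k : Fin (n + 1))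
    (hk : ∀ l : Fin n, l.castSucc < k → σ l = σ' l) : y k = y' k := by
  induction k using Fin.induction with
  | zero => rw [h.init, h'.init]
  | succ k ih =>
    have hσ := hk k (Fin.castSucc_lt_succ)
    have ihk := ih fun l hl => hk l (hl.trans Fin.castSucc_lt_succ)
    obtain ⟨s, v, w, -, h1⟩ := (h.step k).multiplier
    obtain ⟨s', v', w', -, h2⟩ := (h'.step k).multiplier
    rw [← hσ, ← ihk] at h2
    exact h1.unique hγ h2

lemma dotProduct_self_le (hγ : 0 < γ) (h : IsImplicitRun A b c γ σ y xhat) {cbar dlow : ℝ}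
    (hc : ∀ j, |c j| ≤ cbar) (hd0 : 0 < dlow) (hd : ∀ i, dlow ≤ avgRes n b i)
    (k : Fin (n + 1)) : y k ⬝ᵥ y k ≤ (cbar / dlow) ^ 2 := by
  induction k using Fin.induction with
  | zero => rw [h.init]; simp; positivity
  | succ k ih =>
    obtain ⟨s, v, w, -, h1⟩ := (h.step k).multiplier
    exact h1.dotProduct_self_le hγ (hc _) hd0 hd ih

lemma violation_le (hγ : 0 < γ) (hn : 0 < n) (h : IsImplicitRun A b c γ σ y xhat)
    {cbar dlow : ℝ} (hcbar : 0 ≤ cbar)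
    (hc : ∀ j, |c j| ≤ cbar) (hd0 : 0 < dlow) (hd : ∀ i, dlow ≤ avgRes n b i) :
    violation A b xhat ≤ cbar / (γ * dlow) := by
  rw [violation, euclNorm_le_iff (by positivity)]
  have hres : ∀ i, max ((A *ᵥ xhat) i - b i) 0 ≤ γ⁻¹ * y (Fin.last n) i := by
    intro i
    refine max_le ?_ (mul_nonneg (inv_pos.mpr hγ).le (h.iterate_nonneg _ i))
    have h1 : (A *ᵥ xhat) i - b i =
        ∑ k : Fin n, (A i (σ k) * xhat (σ k) - avgRes n b i) := by
      rw [Finset.sum_sub_distrib, Equiv.sum_comp σ (fun j => A i j * xhat j)]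
      have : (n : ℝ) ≠ 0 := by positivity
      simp [Matrix.mulVec, dotProduct, avgRes]
      field_simp
    rw [h1]
    calc _ ≤ ∑ k : Fin n, γ⁻¹ * (y k.succ i - y k.castSucc i) :=
          Finset.sum_le_sum fun k _ => by
            obtain ⟨s, v, w, -, hk⟩ := (h.step k).multiplier
            exact hk.residual_le i
      _ = γ⁻¹ * y (Fin.last n) i := by
          rw [← Finset.mul_sum, sum_succ_sub_castSucc (fun k => y k i), h.init]; simp
  calc _ ≤ (γ⁻¹) ^ 2 * (y (Fin.last n) ⬝ᵥ y (Fin.last n)) := by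
        simp only [dotProduct, Finset.mul_sum]
        refine Finset.sum_le_sum fun i _ => ?_
        have h0 : 0 ≤ max ((A *ᵥ xhat) i - b i) 0 := le_max_right _ _
        nlinarith [hres i]
    _ ≤ (γ⁻¹) ^ 2 * (cbar / dlow) ^ 2 :=
        mul_le_mul_of_nonneg_left (h.dotProduct_self_le hγ hc hd0 hd _) (by positivity)
    _ = _ := by field_simp

/-- The squared norms telescope from `0`, so their contribution is nonnegative and can be dropped.
-/
lemma sum_colFun_le_reward (hγ : 0 < γ) (h : IsImplicitRun A b c γ σ y xhat) {D : ℝ}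
    (hd : ∀ i, |avgRes n b i| ≤ D) (hda : ∀ i j, |avgRes n b i - A i j| ≤ D) :
    ∑ k : Fin n, colFun (avgRes n b) (A.col (σ k)) (c (σ k)) (y k.castSucc)
      - n * (γ * m * D ^ 2 / 2) ≤ c ⬝ᵥ xhat := by
  have h1 : c ⬝ᵥ xhat = ∑ k : Fin n, c (σ k) * xhat (σ k) :=
    (Equiv.sum_comp σ fun j => c j * xhat j).symm
  have h2 : 0 ≤ ∑ k : Fin n,
      (y k.succ ⬝ᵥ y k.succ - y k.castSucc ⬝ᵥ y k.castSucc) / (2 * γ) := by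
    rw [← Finset.sum_div, sum_succ_sub_castSucc (fun k => y k ⬝ᵥ y k), h.init]
    simp only [dotProduct_zero, sub_zero, ← euclNorm_sq]
    positivity
  have h3 := Finset.sum_le_sum fun (k : Fin n) (_ : k ∈ Finset.univ) => by
    obtain ⟨s, v, w, -, hk⟩ := (h.step k).multiplier
    exact hk.colFun_le_reward hγ hd (fun i => hda i (σ k))
  rw [Finset.sum_sub_distrib, Finset.sum_add_distrib, ← h1] at h3
  simp only [Finset.sum_const, Finset.card_univ, Fintype.card_fin, nsmul_eq_mul] at h3
  linarith

end IsImplicitRun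

end Run

end FastOnlineLP

namespace FastOnlineLP

/-! ### Weak duality on the remaining columns. -/

section Duality

variable {m : ℕ}

/-- Weak duality on a subfamily of columns whose resource use exceeds its share by at most `t`. -/
lemma sum_reward_le_sum_colFun {ι : Type*} (P : Finset ι) (a : ι → Fin m → ℝ) (c x : ι → ℝ)
    {d y : Fin m → ℝ} {dlow t : ℝ} (hP : P.Nonempty) (hx0 : ∀ l, 0 ≤ x l) (hx1 : ∀ l, x l ≤ 1)
    (hd0 : 0 < dlow) (hd : ∀ i, dlow ≤ d i) (ht : 0 ≤ t) (hy : 0 ≤ y)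
    (hload : ∀ i, ∑ l ∈ P, a l i * x l ≤ P.card * d i + t) :
    P.card * dlow / (P.card * dlow + t) * ∑ l ∈ P, c l * x l ≤
      ∑ l ∈ P, colFun d (a l) (c l) y := by
  set s : ℝ := (P.card : ℝ) with hs
  have hs0 : 0 < s := by rw [hs]; exact_mod_cast hP.card_pos
  -- Chosen so that `θ * (s * d i + t) ≤ s * d i` whenever `d i ≥ dlow`: the scaled point `θ * x`
  -- stays within the share of the resources.
  set θ : ℝ := s * dlow / (s * dlow + t) with hθ
  have hθ0 : 0 ≤ θ := by positivity
  have hθ1 : θ ≤ 1 := by rw [hθ, div_le_one (by positivity)]; linarith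
  have h1 : ∑ l ∈ P, (d ⬝ᵥ y + θ * x l * (c l - a l ⬝ᵥ y)) ≤
      ∑ l ∈ P, colFun d (a l) (c l) y :=
    Finset.sum_le_sum fun l _ => le_colFun (mul_nonneg hθ0 (hx0 l))
      (mul_le_one₀ hθ1 (hx0 l) (hx1 l))
  have h2 : ∑ l ∈ P, (d ⬝ᵥ y + θ * x l * (c l - a l ⬝ᵥ y)) =
      s * (d ⬝ᵥ y) + θ * ∑ l ∈ P, c l * x l - θ * ∑ l ∈ P, x l * (a l ⬝ᵥ y) := by
    rw [Finset.sum_add_distrib, Finset.sum_const, nsmul_eq_mul, ← hs, Finset.mul_sum,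
      Finset.mul_sum, add_sub_assoc, ← Finset.sum_sub_distrib]
    congr 1
    exact Finset.sum_congr rfl fun l _ => by ring
  have h3 : ∑ l ∈ P, x l * (a l ⬝ᵥ y) = ∑ i, (∑ l ∈ P, a l i * x l) * y i := by
    simp only [dotProduct, Finset.mul_sum, Finset.sum_mul]
    rw [Finset.sum_comm]
    exact Finset.sum_congr rfl fun i _ => Finset.sum_congr rfl fun l _ => by ring
  have h4 : θ * ∑ l ∈ P, x l * (a l ⬝ᵥ y) ≤ s * (d ⬝ᵥ y) := by
    rw [h3, Finset.mul_sum, dotProduct, Finset.mul_sum]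
    refine Finset.sum_le_sum fun i _ => ?_
    rw [← mul_assoc, ← mul_assoc]
    refine mul_le_mul_of_nonneg_right ?_ (hy i)
    refine (mul_le_mul_of_nonneg_left (hload i) hθ0).trans ?_
    rw [hθ, div_mul_eq_mul_div, div_le_iff₀ (by positivity)]
    nlinarith [mul_nonneg hs0.le (mul_nonneg ht (sub_nonneg.mpr (hd i)))]
  linarith

end Duality

/-! ### Expected dual value of one step. -/

section Expectation

variable {m n : ℕ} {A : Matrix (Fin m) (Fin n) ℝ} {b : Fin m → ℝ} {c : Fin n → ℝ} {γ : ℝ}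
  {y : Equiv.Perm (Fin n) → Fin (n + 1) → Fin m → ℝ} {xhat : Equiv.Perm (Fin n) → Fin n → ℝ}

/-- The column met in step `k` is exchangeable with the later ones, given the current iterate. -/
lemma card_mul_expect_colFun (hγ : 0 < γ)
    (hrun : ∀ σ, IsImplicitRun A b c γ σ (y σ) (xhat σ)) (d : Fin m → ℝ) (k : Fin n) :
    ((Finset.Ici k).card : ℝ) *
        (𝔼 σ : Equiv.Perm (Fin n), colFun d (A.col (σ k)) (c (σ k)) (y σ k.castSucc)) =
      𝔼 σ : Equiv.Perm (Fin n),
        ∑ l ∈ Finset.Ici k, colFun d (A.col (σ l)) (c (σ l)) (y σ k.castSucc) := by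
  rw [Finset.expect_sum_comm, ← nsmul_eq_mul, ← Finset.sum_const]
  refine Finset.sum_congr rfl fun l hl => ?_
  rw [← expect_perm_mul_right
    (fun σ => colFun d (A.col (σ l)) (c (σ l)) (y σ k.castSucc)) (Equiv.swap k l)]
  refine Finset.expect_congr rfl fun σ _ => ?_
  -- The swap moves only positions from `k` on, and the iterate before step `k` does not see these.
  have hy : y (σ * Equiv.swap k l) k.castSucc = y σ k.castSucc := by
    refine (hrun _).iterate_congr hγ (hrun σ) _ fun j hj => ?_
    have hjk : j < k := by simpa using hj
    rw [Equiv.Perm.mul_apply, Equiv.swap_apply_of_ne_of_ne hjk.ne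
      (hjk.trans_le (Finset.mem_Ici.mp hl)).ne]
  simp [hy]

/-- The expected dual value met in step `k`, compared with the average reward of a feasible
point. -/
lemma avg_reward_sub_le_expect_colFun (hγ : 0 < γ)
    (hrun : ∀ σ, IsImplicitRun A b c γ σ (y σ) (xhat σ)) {α cbar dlow : ℝ}
    (hα : 0 < α) (hA : ∀ i j, |A i j| ≤ α) (hc : ∀ j, |c j| ≤ cbar) (hd0 : 0 < dlow)
    (hd : ∀ i, dlow ≤ avgRes n b i) {x : Fin n → ℝ} (hx : x ∈ primalFeasible A b) (k : Fin n) :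
    (c ⬝ᵥ x) / n - (2 * α * cbar / dlow * √(Real.log n) * (1 / √((n - k : ℕ) : ℝ))
        + m * cbar * (1 / ((n - k : ℕ) : ℝ))) ≤
      𝔼 σ : Equiv.Perm (Fin n),
        colFun (avgRes n b) (A.col (σ k)) (c (σ k)) (y σ k.castSucc) := by
  obtain ⟨hAx, hx0, hx1⟩ := hx
  have hn : (0 : ℝ) < n := by exact_mod_cast k.pos
  have hcb : 0 ≤ cbar := (abs_nonneg _).trans (hc k)
  have hcard : (Finset.Ici k).card = n - k := Fin.card_Ici k
  have hP : (Finset.Ici k).Nonempty := ⟨k, by simp⟩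
  set P := Finset.Ici k with hPdef
  rw [← hcard]
  set s : ℝ := (P.card : ℝ) with hs
  have hs1 : 1 ≤ s := by rw [hs]; exact_mod_cast hP.card_pos
  have hs0 : 0 < s := by linarith
  have hsn : s ≤ n := by rw [hs, hcard]; exact_mod_cast Nat.sub_le _ _
  set t : ℝ := 2 * α * √(s * Real.log s) with ht
  have ht0 : 0 ≤ t := by positivity
  set θ : ℝ := s * dlow / (s * dlow + t) with hθ
  have hθ0 : 0 ≤ θ := by positivity
  have hθ1 : θ ≤ 1 := by rw [hθ, div_le_one (by positivity)]; linarith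
  have hcx : ∀ j, c j * x j ≤ cbar := fun j =>
    ((le_abs_self _).trans_eq (abs_mul _ _)).trans <| by
      rw [abs_of_nonneg (hx0 j)]
      exact (mul_le_of_le_one_right (abs_nonneg _) (hx1 j)).trans (hc j)
  -- Overload of resource `i` among the remaining columns. If some overload occurs, subtracting `s *
  -- cbar` makes the lower bound nonpositive, and the dual values are nonnegative. Each overload has
  -- probability at most `1 / s`, hence the loss `m * cbar / s` per step after division by `s`.
  let bad : Fin m → Equiv.Perm (Fin n) → ℝ := fun i σ =>
    if s * avgRes n b i + t < ∑ l ∈ P, A i (σ l) * x (σ l) then 1 else 0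
  have hbad0 : ∀ i σ, 0 ≤ bad i σ := fun i σ => by
    simp only [bad]; split_ifs <;> norm_num
  have hpath : ∀ σ : Equiv.Perm (Fin n),
      θ * (∑ l ∈ P, c (σ l) * x (σ l)) - s * cbar * ∑ i, bad i σ ≤
        ∑ l ∈ P, colFun (avgRes n b) (A.col (σ l)) (c (σ l)) (y σ k.castSucc) := by
    intro σ
    have hy := (hrun σ).iterate_nonneg k.castSucc
    by_cases hgood : ∀ i, ∑ l ∈ P, A i (σ l) * x (σ l) ≤ s * avgRes n b i + t
    · have h1 := sum_reward_le_sum_colFun P (fun l => A.col (σ l)) (fun l => c (σ l))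
        (fun l => x (σ l)) hP (fun l => hx0 _) (fun l => hx1 _) hd0 hd ht0 hy hgood
      have h2 : 0 ≤ s * cbar * ∑ i, bad i σ :=
        mul_nonneg (by positivity) (Finset.sum_nonneg fun i _ => hbad0 i σ)
      exact (sub_le_self _ h2).trans h1
    · push Not at hgood
      obtain ⟨i, hi⟩ := hgood
      have h1 : 1 ≤ ∑ i, bad i σ := by
        have : bad i σ = 1 := if_pos hi
        rw [← this]
        exact Finset.single_le_sum (fun i _ => hbad0 i σ) (Finset.mem_univ i)
      have h2 : ∑ l ∈ P, c (σ l) * x (σ l) ≤ s * cbar := by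
        rw [hs, ← nsmul_eq_mul]
        exact Finset.sum_le_card_nsmul _ _ _ fun l _ => hcx _
      have h3 : θ * (∑ l ∈ P, c (σ l) * x (σ l)) ≤ s * cbar :=
        (mul_le_mul_of_nonneg_left h2 hθ0).trans (mul_le_of_le_one_left (by positivity) hθ1)
      have h4 : s * cbar ≤ s * cbar * ∑ i, bad i σ := le_mul_of_one_le_right (by positivity) h1
      have h5 : 0 ≤ ∑ l ∈ P, colFun (avgRes n b) (A.col (σ l)) (c (σ l)) (y σ k.castSucc) :=
        Finset.sum_nonneg fun l _ => colFun_nonneg (fun i => hd0.le.trans (hd i)) hy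
      linarith
  have hE := Finset.expect_le_expect (s := Finset.univ) fun σ _ => hpath σ
  rw [← card_mul_expect_colFun hγ hrun, Finset.expect_sub_distrib, ← Finset.mul_expect,
    ← Finset.mul_expect, Finset.expect_sum_comm, Finset.expect_sum_comm, ← hPdef, ← hs] at hE
  have hmean : ∑ l ∈ P, (𝔼 σ : Equiv.Perm (Fin n), c (σ l) * x (σ l)) = s * ((c ⬝ᵥ x) / n) := by
    rw [Finset.sum_congr rfl fun l _ => expect_perm_apply (fun j => c j * x j) l]
    simp [hs, dotProduct]
  have hprob : ∑ i, (𝔼 σ : Equiv.Perm (Fin n), bad i σ) ≤ m * (1 / s) := by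
    have : ∀ i, (𝔼 σ : Equiv.Perm (Fin n), bad i σ) ≤ 1 / s := fun i => by
      refine expect_perm_tail_le (fun j => A i j * x j) hα (fun j => ?_) ?_ P hP
      · rw [abs_mul, abs_of_nonneg (hx0 j)]
        exact (mul_le_of_le_one_right (abs_nonneg _) (hx1 j)).trans (hA i j)
      · exact div_le_div_of_nonneg_right (hAx i) hn.le
    exact (Finset.sum_le_card_nsmul _ _ _ fun i _ => this i).trans_eq (by simp)
  rw [hmean] at hE
  set e := 𝔼 σ : Equiv.Perm (Fin n),
        colFun (avgRes n b) (A.col (σ k)) (c (σ k)) (y σ k.castSucc)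
  have h1 : θ * ((c ⬝ᵥ x) / n) - m * cbar * (1 / s) ≤ e := by
    have h2 := mul_le_mul_of_nonneg_left hprob (show 0 ≤ s * cbar by positivity)
    have h3 : s * (θ * ((c ⬝ᵥ x) / n) - m * cbar * (1 / s)) ≤ s * e := by
      linarith
    exact le_of_mul_le_mul_left h3 hs0
  have h2 : (c ⬝ᵥ x) / n ≤ cbar := by
    rw [div_le_iff₀ hn, mul_comm]
    simpa [dotProduct] using Finset.sum_le_sum fun (j : Fin n) (_ : j ∈ Finset.univ) => hcx j
  have h3 : 1 - θ ≤ 2 * α / dlow * √(Real.log n) * (1 / √s) := by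
    have hθ' : 1 - θ ≤ t / (s * dlow) := by
      rw [hθ, one_sub_div (by positivity), add_sub_cancel_left]
      exact div_le_div_of_nonneg_left ht0 (by positivity) (by linarith)
    refine hθ'.trans ?_
    have hss : s = √s * √s := (Real.mul_self_sqrt hs0.le).symm
    have hl : √(Real.log s) ≤ √(Real.log n) := Real.sqrt_le_sqrt (Real.log_le_log hs0 hsn)
    have hq : 0 < √s := Real.sqrt_pos.mpr hs0
    calc t / (s * dlow) = 2 * α / dlow * √(Real.log s) * (√s / s) := by
          rw [ht, Real.sqrt_mul hs0.le]; ring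
      _ = 2 * α / dlow * √(Real.log s) * (1 / √s) := by
          congr 1
          rw [div_eq_div_iff hs0.ne' hq.ne', one_mul]; exact hss.symm
      _ ≤ _ := mul_le_mul_of_nonneg_right (mul_le_mul_of_nonneg_left hl (by positivity))
          (one_div_pos.mpr hq).le
  have h4 : (1 - θ) * ((c ⬝ᵥ x) / n) ≤ 2 * α * cbar / dlow * √(Real.log n) * (1 / √s) := by
    calc _ ≤ (1 - θ) * cbar := mul_le_mul_of_nonneg_left h2 (by linarith)
      _ ≤ 2 * α / dlow * √(Real.log n) * (1 / √s) * cbar := mul_le_mul_of_nonneg_right h3 hcb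
      _ = _ := by ring
  linarith

end Expectation

/-! ### Summing the sampling losses. -/

section Sums

lemma sum_fin_tsub (n : ℕ) (g : ℕ → ℝ) :
    ∑ k : Fin n, g (n - k) = ∑ i ∈ Finset.range n, g (i + 1) := by
  rw [← Equiv.sum_comp Fin.revPerm, ← Fin.sum_univ_eq_sum_range (fun i => g (i + 1))]
  refine Finset.sum_congr rfl fun k _ => ?_
  congr 1
  simp [Fin.val_rev]
  omega

lemma sum_range_inv_sqrt_le (n : ℕ) :
    ∑ i ∈ Finset.range n, 1 / √((i + 1 : ℕ) : ℝ) ≤ 2 * √n := by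
  induction n with
  | zero => simp
  | succ n ih =>
    rw [Finset.sum_range_succ]
    have h0 : 0 < √((n + 1 : ℕ) : ℝ) := Real.sqrt_pos.mpr (by positivity)
    have h1 : √((n + 1 : ℕ) : ℝ) ^ 2 = n + 1 := by
      rw [Real.sq_sqrt (by positivity)]; push_cast; ring
    have h2 : √(n : ℝ) ^ 2 = n := Real.sq_sqrt (by positivity)
    have : 1 / √((n + 1 : ℕ) : ℝ) ≤ 2 * √((n + 1 : ℕ) : ℝ) - 2 * √n := by
      rw [div_le_iff₀ h0]
      nlinarith [sq_nonneg (√((n + 1 : ℕ) : ℝ) - √n)]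
    linarith

lemma sum_range_inv_le (n : ℕ) :
    ∑ i ∈ Finset.range n, 1 / ((i + 1 : ℕ) : ℝ) ≤ 1 + Real.log n := by
  have := harmonic_le_one_add_log n
  simpa [harmonic] using this

/-- The total sampling loss over all steps. -/
lemma sum_sampling_loss_le {m n : ℕ} (hn : 2 ≤ n) {p q : ℝ} (hp : 0 ≤ p) (hq : 0 ≤ q) :
    ∑ k : Fin n, (p * √(Real.log n) * (1 / √((n - k : ℕ) : ℝ))
        + m * q * (1 / ((n - k : ℕ) : ℝ))) ≤
      (4 * p + 5 * q) * (m * Real.log n + √n * Real.log n) := by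
  -- This absorbs the lower-order terms: `√(log n) ≤ 2 * log n` and `1 + log n ≤ 5 * log n`, the
  -- source of the factors `4` and `5`.
  have hlog : 1 / 4 ≤ Real.log n := by
    have h1 : Real.log 2 ≤ Real.log n := Real.log_le_log (by norm_num) (by exact_mod_cast hn)
    linarith [Real.log_two_gt_d9]
  have hsqrt : √(Real.log n) ≤ 2 * Real.log n := by
    rw [Real.sqrt_le_left (by linarith)]
    nlinarith
  rw [sum_fin_tsub n fun j => p * √(Real.log n) * (1 / √(j : ℝ)) + m * q * (1 / (j : ℝ)),
    Finset.sum_add_distrib, ← Finset.mul_sum, ← Finset.mul_sum]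
  have h1 : p * √(Real.log n) * ∑ i ∈ Finset.range n, 1 / √((i + 1 : ℕ) : ℝ) ≤
      p * (2 * Real.log n) * (2 * √n) := by
    gcongr
    exact sum_range_inv_sqrt_le n
  have h2 : m * q * ∑ i ∈ Finset.range n, 1 / ((i + 1 : ℕ) : ℝ) ≤ m * q * (5 * Real.log n) := by
    gcongr
    linarith [sum_range_inv_le n]
  have h3 : 0 ≤ p * (m * Real.log n) := by positivity
  have h4 : 0 ≤ q * (√n * Real.log n) := by positivity
  linarith

end Sums

/-! ### Arithmetic of the stepsize. -/

section Stepsize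

variable {cbar dlow D μ ν : ℝ}

lemma regret_eq_mul_stepsize (hc : 0 < cbar) (hd : 0 < dlow) (hD : 0 < D) (hμ : 0 < μ)
    (hν : 0 < ν) :
    √(5 * D ^ 2 * cbar / (2 * dlow)) * √(μ * ν) =
      5 / 2 * (ν * (√(2 * cbar / (5 * dlow * D ^ 2 * μ * ν)) * μ * D ^ 2)) := by
  have h := Real.sq_sqrt (show 0 ≤ 2 * cbar / (5 * dlow * D ^ 2 * μ * ν) by positivity)
  have h0 := Real.sqrt_nonneg (2 * cbar / (5 * dlow * D ^ 2 * μ * ν))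
  generalize √(2 * cbar / (5 * dlow * D ^ 2 * μ * ν)) = g at h h0 ⊢
  rw [← Real.sqrt_mul (by positivity), ← Real.sqrt_sq (show 0 ≤ 5 / 2 * (ν * (g * μ * D ^ 2)) by
    positivity)]
  congr 1
  have : (5 / 2 * (ν * (g * μ * D ^ 2))) ^ 2 = 25 / 4 * (ν * μ * D ^ 2) ^ 2 * g ^ 2 := by ring
  rw [this, h]
  field_simp
  norm_num

lemma div_stepsize_eq_regret (hc : 0 < cbar) (hd : 0 < dlow) (hD : 0 < D) (hμ : 0 < μ)
    (hν : 0 < ν) :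
    cbar / (√(2 * cbar / (5 * dlow * D ^ 2 * μ * ν)) * dlow) =
      √(5 * D ^ 2 * cbar / (2 * dlow)) * √(μ * ν) := by
  rw [regret_eq_mul_stepsize hc hd hD hμ hν]
  have h := Real.sq_sqrt (show 0 ≤ 2 * cbar / (5 * dlow * D ^ 2 * μ * ν) by positivity)
  have h0 : 0 < √(2 * cbar / (5 * dlow * D ^ 2 * μ * ν)) := Real.sqrt_pos.mpr (by positivity)
  generalize √(2 * cbar / (5 * dlow * D ^ 2 * μ * ν)) = g at h h0 ⊢
  rw [div_eq_iff (by positivity)]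
  rw [eq_div_iff (by positivity)] at h
  linear_combination -h / 2

end Stepsize

/-! ### Expected dual values over the whole run. -/

section Gap

variable {m n : ℕ} {A : Matrix (Fin m) (Fin n) ℝ} {b : Fin m → ℝ} {c : Fin n → ℝ} {γ : ℝ}
  {y : Equiv.Perm (Fin n) → Fin (n + 1) → Fin m → ℝ} {xhat : Equiv.Perm (Fin n) → Fin n → ℝ}

lemma reward_le_expect_sum_colFun (hγ : 0 < γ) (hn : 0 < n)
    (hrun : ∀ σ, IsImplicitRun A b c γ σ (y σ) (xhat σ)) {α cbar dlow : ℝ}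
    (hα : 0 < α) (hA : ∀ i j, |A i j| ≤ α) (hc : ∀ j, |c j| ≤ cbar) (hd0 : 0 < dlow)
    (hd : ∀ i, dlow ≤ avgRes n b i) {x : Fin n → ℝ} (hx : x ∈ primalFeasible A b) :
    c ⬝ᵥ x ≤ (𝔼 σ : Equiv.Perm (Fin n), ∑ k : Fin n,
        colFun (avgRes n b) (A.col (σ k)) (c (σ k)) (y σ k.castSucc)) +
      (4 * (2 * α * cbar / dlow) + 5 * cbar) * (m * Real.log n + √n * Real.log n) := by
  have hcb : 0 ≤ cbar := (abs_nonneg _).trans (hc ⟨0, hn⟩)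
  rcases Nat.lt_or_ge n 2 with h1 | h2
  -- Here `log n = 0` leaves no room for a loss, but the single column is the whole program, so weak
  -- duality holds with `t = 0`.
  · obtain rfl : n = 1 := by omega
    have : c ⬝ᵥ x ≤ 𝔼 σ : Equiv.Perm (Fin 1), ∑ k : Fin 1,
        colFun (avgRes 1 b) (A.col (σ k)) (c (σ k)) (y σ k.castSucc) := by
      rw [← Fintype.expect_const (ι := Equiv.Perm (Fin 1)) (c ⬝ᵥ x)]
      refine Finset.expect_le_expect fun σ _ => ?_
      obtain ⟨hAx, hx0, hx1⟩ := hx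
      have := sum_reward_le_sum_colFun Finset.univ (fun l => A.col (σ l)) (fun l => c (σ l))
        (fun l => x (σ l)) (t := 0) Finset.univ_nonempty (fun l => hx0 _) (fun l => hx1 _)
        hd0 hd le_rfl ((hrun σ).iterate_nonneg 0) (fun i => by
          have := hAx i
          rw [Subsingleton.elim σ 1]
          simpa [avgRes, Matrix.mulVec, dotProduct] using this)
      rw [Subsingleton.elim σ 1] at this ⊢
      simpa [dotProduct, hd0.ne'] using this
    simpa using this
  · have hn0 : (n : ℝ) ≠ 0 := by positivity
    have h3 := Finset.sum_le_sum fun (k : Fin n) (_ : k ∈ Finset.univ) =>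
      avg_reward_sub_le_expect_colFun hγ hrun hα hA hc hd0 hd hx k
    rw [Finset.sum_sub_distrib, ← Finset.expect_sum_comm] at h3
    have h4 := sum_sampling_loss_le (m := m) h2 (show 0 ≤ 2 * α * cbar / dlow by positivity) hcb
    have h5 : ∑ _k : Fin n, (c ⬝ᵥ x) / n = c ⬝ᵥ x := by
      simp; field_simp
    rw [h5] at h3
    linarith

end Gap

end FastOnlineLP

/-! ### Assembly of both bounds. -/

theorem theorem2 (abar cbar dlow : ℝ) (hcbar : 0 < cbar) :
    ∃ C : ℝ, ∀ (m n : ℕ) (dbar : ℝ) (A : Matrix (Fin m) (Fin n) ℝ) (b : Fin m → ℝ)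
      (c : Fin n → ℝ), 0 < n →
      FastOnlineLP.Assumptions A b c abar cbar dlow dbar →
      ∀ (y : Equiv.Perm (Fin n) → Fin (n + 1) → Fin m → ℝ)
        (xhat : Equiv.Perm (Fin n) → Fin n → ℝ),
        (∀ σ, FastOnlineLP.IsImplicitRun A b c
          (FastOnlineLP.stepsize abar cbar dlow dbar m n) σ (y σ) (xhat σ)) →
        ((𝔼 σ, FastOnlineLP.optGap A b c (xhat σ)) ≤
          C * (m * Real.log n + √n * Real.log n)
            + √(5 * (abar + dbar) ^ 2 * cbar / (2 * dlow)) * √(m * n)) ∧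
        ((𝔼 σ, FastOnlineLP.violation A b (xhat σ)) ≤
          3 * m * (abar + dbar) ^ 2 / dlow + √m * (abar + dbar)
            + √(5 * (abar + dbar) ^ 2 * cbar / (2 * dlow)) * √(m * n)) := by
  -- The entry bound is enlarged to `|abar| + 1` because the tail estimate divides by it, and `abar`
  -- may be `0`.
  refine ⟨4 * (2 * (|abar| + 1) * cbar / dlow) + 5 * cbar, ?_⟩
  intro m n dbar A b c hn hass y xhat hrun
  have hd0 := hass.dlow_pos
  have hd : ∀ i, dlow ≤ FastOnlineLP.avgRes n b i := fun i => hass.min_d.2 ⟨i, rfl⟩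
  have hd' : ∀ i, FastOnlineLP.avgRes n b i ≤ dbar := fun i => hass.max_d.2 ⟨i, rfl⟩
  obtain ⟨i₀, -⟩ := hass.min_d.1
  have habar : 0 ≤ abar := (abs_nonneg _).trans (hass.bound_a ⟨0, hn⟩ i₀)
  have hdbar : 0 < dbar := hd0.trans_le ((hd i₀).trans (hd' i₀))
  have hD : 0 < abar + dbar := by linarith
  have hm0 : (0 : ℝ) < m := by exact_mod_cast i₀.pos
  have hn0 : (0 : ℝ) < n := by exact_mod_cast hn
  set γ := FastOnlineLP.stepsize abar cbar dlow dbar m n with hγdef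
  have hγ : 0 < γ := Real.sqrt_pos.mpr (by positivity)
  have hR1 := FastOnlineLP.div_stepsize_eq_regret hcbar hd0 hD hm0 hn0
  have hR2 := FastOnlineLP.regret_eq_mul_stepsize hcbar hd0 hD hm0 hn0
  set R := √(5 * (abar + dbar) ^ 2 * cbar / (2 * dlow)) * √((m : ℝ) * n)
  change cbar / (γ * dlow) = R at hR1
  change R = 5 / 2 * (n * (γ * m * (abar + dbar) ^ 2)) at hR2
  constructor
  · have hlow : ∀ x ∈ FastOnlineLP.primalFeasible A b, c ⬝ᵥ x ≤
        (𝔼 σ, c ⬝ᵥ xhat σ) + ((4 * (2 * (|abar| + 1) * cbar / dlow) + 5 * cbar) *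
          (m * Real.log n + √n * Real.log n) + R) := by
      intro x hx
      have h1 := FastOnlineLP.reward_le_expect_sum_colFun hγ hn hrun (α := |abar| + 1)
        (by positivity) (fun i j => (hass.bound_a j i).trans (by linarith [le_abs_self abar]))
        hass.bound_c hd0 hd hx
      have h2 := Finset.expect_le_expect (s := Finset.univ) fun σ _ =>
        (hrun σ).sum_colFun_le_reward hγ (D := abar + dbar)
          (fun i => abs_le.mpr ⟨by linarith [hd i], by linarith [hd' i]⟩)
          (fun i j => by
            have := abs_le.mp (hass.bound_a j i)
            exact abs_le.mpr ⟨by linarith [hd i], by linarith [hd' i]⟩)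
      rw [Finset.expect_sub_distrib, Fintype.expect_const] at h2
      -- The stepsize loss is half of this quantity, while `R` is `5 / 2` of it.
      have h3 : 0 < n * (γ * m * (abar + dbar) ^ 2) := by positivity
      linarith
    have hopt : FastOnlineLP.optValue A b c ≤ (𝔼 σ, c ⬝ᵥ xhat σ) +
        ((4 * (2 * (|abar| + 1) * cbar / dlow) + 5 * cbar) *
          (m * Real.log n + √n * Real.log n) + R) := by
      refine csSup_le ⟨_, 0, ⟨fun i => ?_, le_rfl, zero_le_one⟩, rfl⟩ ?_
      · have := hd0.le.trans (hd i)
        rw [FastOnlineLP.avgRes, le_div_iff₀ hn0] at this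
        simpa using this
      · rintro _ ⟨x, hx, rfl⟩
        exact hlow x hx
    simp only [FastOnlineLP.optGap]
    rw [Finset.expect_sub_distrib, Fintype.expect_const]
    linarith
  · have h1 := Finset.expect_le_expect (s := Finset.univ) fun σ _ =>
      (hrun σ).violation_le hγ hn hcbar.le hass.bound_c hd0 hd
    rw [Fintype.expect_const, hR1] at h1
    -- `R` alone already bounds the violation; the other terms only need to be nonnegative.
    have h2 : 0 ≤ 3 * m * (abar + dbar) ^ 2 / dlow + √m * (abar + dbar) := by positivity
    linarith
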